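/- Fix a set $A$ of atoms. A \emph{supported set} over $A$ is a set $X$ with a map $s_X\colon X\to\mathcal P_{\mathsf f}(A)$ into the finite subsets of $A$; a \emph{supported map} $f\colon X\to Y$ is a map with $s_Y(f(x))\subseteq s_X(x)$ for all $x\in X$. These form the category $\mathsf{Supp}(A)$. Let $M\le A^A$ be a monoid of maps $A\to A$ under composition, and let $X$ be a set with an action of $M$. A subset $S\subseteq A$ \emph{supports} $x\in X$ if $m\cdot x=m'\cdot x$ for all $m,m'\in M$ that agree on $S$; $X$ is a \emph{nominal $M$-set} if each of its elements is supported by a finite set. $\mathsf{Nom}(M)$ is the category of nominal $M$-sets and equivariant maps, and $U\colon\mathsf{Nom}(M)\to\mathsf{Supp}(A)$ is the functor that keeps the underlying set and map and sets $s_{UX}(x)=\bigcap\{S\subseteq A\mid S\text{ finite and supports }x\}$. The monoid $M$ \emph{admits least supports} if every element of every nominal $M$-set has a least finite support, and it is \emph{lock-free} if for every finite $R\subseteq A$ and $a\in A\setminus R$ there is $\ell\in M$ that fixes $R$ pointwise and satisfies $\ell(a)\ne a$. For finite $S\subseteq A$ and $m\in M$ let $[m]_S$ be the class of all $m'\in M$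 that agree with $m$ on $S$. Let $F\colon\mathsf{Supp}(A)\to\mathsf{Nom}(M)$ be given by $FX=\{([m]_{s_X(x)},x)\mid x\in X,\ m\in M\}$ with action $\ell\cdot([m],x)=([\ell m],x)$ and $Ff([m]_{s_X(x)},x)=([m]_{s_Y(f(x))},f(x))$. A functor $U\colon\mathcal D\to\mathcal C$ is \emph{monadic} via a monad $T$ on $\mathcal C$ if there is an isomorphism of categories from $\mathcal D$ to the Eilenberg--Moore category of $T$ that carries $U$ to the forgetful functor. Let $\mathbb A$ be a countably infinite set. In each of the following three cases the monoid $M\le A^A$ admits least supports and is lock-free; $F$ is left adjoint to $U$ with unit $x\mapsto([\mathrm{id}]_{s_X(x)},x)$; and $U\colon\mathsf{Nom}(M)\to\mathsf{Supp}(A)$ is monadic via the given monad $T$, to which the monad of the adjunction $F\dashv U$ is isomorphic through $([m]_{s_X(x)},x)\mapsto(m|_{s_X(x)},x)$. 1. Nominal sets for the equality symmetry: $A=\mathbb A$, $M$ is the group of bijections $\mathbb A\to\mathbb A$ fixing all but finitely many atoms, and $TX=\{(\pi,x)\mid x\in X,\ \pi\colon s_X(x)\to\mathbb A\text{ injective}\}$.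 2. Nominal renaming sets: $A=\mathbb A$, $M$ is the monoid of all maps $\mathbb A\to\mathbb A$ fixing all but finitely many atoms, and $TX=\{(\pi,x)\mid x\in X,\ \pi\colon s_X(x)\to\mathbb A\}$. 3. Nominal sets for the total order symmetry: $A=\mathbb Q$, $M$ is the group of monotone bijections $\mathbb Q\to\mathbb Q$, and $TX=\{(\pi,x)\mid x\in X,\ \pi\colon s_X(x)\to\mathbb Q,\ \pi(q)<\pi(p)\text{ for all }q<p\text{ in }s_X(x)\}$. In all three cases $s_{TX}(\pi,x)=\pi[s_X(x)]$, $Tf(\pi,x)=(\pi|_{s_Y(f(x))},f(x))$ for supported $f\colon X\to Y$, the unit sends $x$ to $(s_X(x)\hookrightarrow A,\,x)$ and the multiplication sends $(\rho,(\pi,x))$ to $(\rho\circ\pi,x)$. Moreover, $\mathbb Q\cong\mathbb A$, and for every bijection $e\colon\mathbb Q\to\mathbb A$ the composite of $U$ in case 3 with the relabelling functor $\mathsf{Supp}(\mathbb Q)\to\mathsf{Supp}(\mathbb A)$, $(X,s_X)\mapsto(X,\,x\mapsto e[s_X(x)])$, is monadic (via some monad on $\mathsf{Supp}(\mathbb A)$).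 -/

import Mathlib

open CategoryTheory

universe u v w

namespace Nominal

/-! ### Supported sets -/

/-- A supported set over `A`: a set together with a map to the finite subsets of `A`. -/
structure SuppSet (A : Type v) : Type (max v (w + 1)) where
  carrier : Type w
  supp : carrier → Finset A

/-- A supported map: it may forget atoms but never introduces new ones. -/
@[ext]
structure SuppSet.Hom {A : Type v} (X Y : SuppSet.{v, w} A) : Type w where
  toFun : X.carrier → Y.carrier
  supp_subset : ∀ x, Y.supp (toFun x) ⊆ X.supp x

instance {A : Type v} : Category.{w} (SuppSet.{v, w} A) where
  Hom X Y := SuppSet.Hom X Y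
  id _ := ⟨fun x => x, fun _ => Finset.Subset.refl _⟩
  comp f g := ⟨fun x => g.toFun (f.toFun x),
    fun x => (g.supp_subset (f.toFun x)).trans (f.supp_subset x)⟩

/-- Relabelling the atoms along a bijection. -/
def SuppSet.relabel {A : Type u} {B : Type v} (e : A ≃ B) :
    SuppSet.{u, w} A ⥤ SuppSet.{v, w} B where
  obj X := ⟨X.carrier, fun x => (X.supp x).map e.toEmbedding⟩
  map f := ⟨f.toFun, fun x => Finset.map_subset_map.2 (f.supp_subset x)⟩

/-! ### Nominal `M`-sets for a monoid `M` of maps `A → A` -/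

/-- `S` supports `x` if any two elements of `M` that are identical on `S` act in the same
way on `x`. -/
def Supports {A : Type v} (M : Submonoid (Function.End A)) {X : Type w} [MulAction M X]
    (S : Set A) (x : X) : Prop :=
  ∀ m m' : M, (∀ a ∈ S, m.1 a = m'.1 a) → m • x = m' • x

/-- A nominal `M`-set: an `M`-set in which every element has a finite support. -/
structure NomSet {A : Type v} (M : Submonoid (Function.End A)) : Type (max v (w + 1)) where
  carrier : Type w
  [action : MulAction M carrier]
  nominal : ∀ x : carrier, ∃ S : Finset A, Supports M (S : Set A) x

attribute [instance] NomSet.action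

/-- Morphisms of nominal `M`-sets are the equivariant maps. -/
@[ext]
structure NomSet.Hom {A : Type v} {M : Submonoid (Function.End A)} (X Y : NomSet.{v, w} M) :
    Type w where
  hom : X.carrier →[M] Y.carrier

instance {A : Type v} {M : Submonoid (Function.End A)} : Category.{w} (NomSet.{v, w} M) where
  Hom X Y := NomSet.Hom X Y
  id X := ⟨MulActionHom.id M⟩
  comp f g := ⟨g.hom.comp f.hom⟩

/-- Every element of every nominal `M`-set (in the universe `w`) has a least finite support. -/
def AdmitsLeastSupports {A : Type v} (M : Submonoid (Function.End A)) : Prop :=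
  ∀ (X : NomSet.{v, w} M) (x : X.carrier),
    ∃ S : Finset A, IsLeast {S : Finset A | Supports M (S : Set A) x} S

/-- Lock-freeness: whenever `a` is outside the finite set `R`, some element of `M` moves `a`
while fixing `R` pointwise. -/
def LockFree {A : Type v} (M : Submonoid (Function.End A)) : Prop :=
  ∀ (R : Finset A) (a : A), a ∉ R → ∃ l ∈ M, (∀ b ∈ R, l b = b) ∧ l a ≠ a

theorem finite_supp {A : Type v} {M : Submonoid (Function.End A)} (X : NomSet.{v, w} M)
    (x : X.carrier) : {a : A | ∀ S : Finset A, Supports M (S : Set A) x → a ∈ S}.Finite := by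
  obtain ⟨S, hS⟩ := X.nominal x
  exact S.finite_toSet.subset fun a ha => ha S hS

/-- The intersection of all finite supports of `x`; it is the least finite support whenever there
is one. -/
noncomputable def NomSet.supp {A : Type v} {M : Submonoid (Function.End A)} (X : NomSet.{v, w} M)
    (x : X.carrier) : Finset A :=
  (finite_supp X x).toFinset

theorem NomSet.mem_supp {A : Type v} {M : Submonoid (Function.End A)} {X : NomSet.{v, w} M}
    {x : X.carrier} {a : A} :
    a ∈ X.supp x ↔ ∀ S : Finset A, Supports M (S : Set A) x → a ∈ S := by
  simp [NomSet.supp]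

theorem Supports.map {A : Type v} {M : Submonoid (Function.End A)} {X Y : NomSet.{v, w} M}
    (f : X.carrier →[M] Y.carrier) {S : Set A} {x : X.carrier} (h : Supports M S x) :
    Supports M S (f x) := by
  intro m m' hm
  rw [← map_smul, ← map_smul, h m m' hm]

/-- The forgetful functor from nominal `M`-sets to supported sets. -/
noncomputable def forgetToSupp {A : Type v} (M : Submonoid (Function.End A)) :
    NomSet.{v, w} M ⥤ SuppSet.{v, w} A where
  obj X := ⟨X.carrier, X.supp⟩
  map f := ⟨fun x => f.hom x, fun _ _ ha =>
    NomSet.mem_supp.2 fun S hS => NomSet.mem_supp.1 ha S (hS.map f.hom)⟩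

/-! ### The free nominal `M`-set on a supported set -/

/-- Being identical on `S`. -/
def restSetoid {A : Type v} (M : Submonoid (Function.End A)) (S : Finset A) : Setoid M where
  r m m' := ∀ a ∈ S, m.1 a = m'.1 a
  iseqv := ⟨fun _ _ _ => rfl, fun h a ha => (h a ha).symm,
    fun h h' a ha => (h a ha).trans (h' a ha)⟩

/-- The set of classes `[m]_S` of elements of `M` identical on `S`. -/
def RestMon {A : Type v} (M : Submonoid (Function.End A)) (S : Finset A) : Type v :=
  Quotient (restSetoid M S)

/-- The class `[m]_S`. -/
def RestMon.mk {A : Type v} {M : Submonoid (Function.End A)} (S : Finset A) (m : M) :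
    RestMon M S :=
  Quotient.mk (restSetoid M S) m

/-- `[m]_S ↦ [m]_R` for `R ⊆ S`. -/
def RestMon.restrict {A : Type v} {M : Submonoid (Function.End A)} {R S : Finset A} (h : R ⊆ S) :
    RestMon M S → RestMon M R :=
  Quotient.map' (s₁ := restSetoid M S) (s₂ := restSetoid M R) id
    (fun _ _ hm a ha => hm a (h ha))

/-- The action `l • [m]_S = [l * m]_S`. -/
instance {A : Type v} (M : Submonoid (Function.End A)) (S : Finset A) :
    MulAction M (RestMon M S) where
  smul l := Quotient.map' (s₁ := restSetoid M S) (s₂ := restSetoid M S) (fun m => l * m)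
    (fun _ _ hm a ha => congrArg l.1 (hm a ha))
  one_smul q := by
    induction q using Quotient.inductionOn'
    exact congrArg (RestMon.mk S) (one_mul _)
  mul_smul l l' q := by
    induction q using Quotient.inductionOn'
    exact congrArg (RestMon.mk S) (mul_assoc _ _ _)

/-- The free nominal `M`-set on `X`: the pairs `([m]_{supp x}, x)`, with the action on the
first component. -/
def freeObj {A : Type v} (M : Submonoid (Function.End A)) (X : SuppSet.{v, max u v} A) :
    NomSet.{v, max u v} M where
  carrier := Σ x : X.carrier, RestMon M (X.supp x)
  action :=
    { smul := fun l p => ⟨p.1, l • p.2⟩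
      one_smul := fun p => Sigma.ext rfl (heq_of_eq (one_smul M p.2))
      mul_smul := fun l l' p => Sigma.ext rfl (heq_of_eq (mul_smul l l' p.2)) }
  nominal := by
    classical
    rintro ⟨x, q⟩
    induction q using Quotient.inductionOn' with
    | h m =>
      refine ⟨(X.supp x).image m.1, fun l l' h => Sigma.ext rfl (heq_of_eq ?_)⟩
      exact Quotient.sound (s := restSetoid M (X.supp x)) fun a ha =>
        h (m.1 a) (by exact_mod_cast Finset.mem_image_of_mem m.1 ha)

/-- The free functor, `([m]_{supp x}, x) ↦ ([m]_{supp (f x)}, f x)` on maps. -/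
def free {A : Type v} (M : Submonoid (Function.End A)) :
    SuppSet.{v, max u v} A ⥤ NomSet.{v, max u v} M where
  obj X := freeObj.{u, v} M X
  map {X Y} f := ⟨{
    toFun := fun p : (freeObj.{u, v} M X).carrier =>
      (⟨f.toFun p.1, RestMon.restrict (f.supp_subset p.1) p.2⟩ : (freeObj.{u, v} M Y).carrier)
    map_smul' := by
      rintro l ⟨x, q⟩
      induction q using Quotient.inductionOn'
      rfl }⟩
  map_id X := by
    refine NomSet.Hom.ext (MulActionHom.ext ?_)
    rintro ⟨x, q⟩
    induction q using Quotient.inductionOn'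
    rfl
  map_comp f g := by
    refine NomSet.Hom.ext (MulActionHom.ext ?_)
    rintro ⟨x, q⟩
    induction q using Quotient.inductionOn'
    rfl

/-! ### Explicit monads on supported sets -/

/-- The finite set of values of a map on a finite set of atoms. -/
noncomputable def imageOf {A : Type v} {S : Finset A} (p : S → A) : Finset A :=
  (Set.finite_range p).toFinset

theorem mem_imageOf {A : Type v} {S : Finset A} (p : S → A) (a : S) : p a ∈ imageOf p := by
  simp [imageOf]

theorem imageOf_subset {A : Type v} {S R : Finset A} {p : S → A} (h : ∀ a, p a ∈ R) :
    imageOf p ⊆ R := by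
  intro b hb
  obtain ⟨a, rfl⟩ := (Set.finite_range p).mem_toFinset.1 hb
  exact h a

/-- A class of maps from finite sets of atoms to `A` that contains the inclusions and is closed
under restriction and composition. -/
structure OpClass (A : Type v) where
  /-- The maps `S → A` that belong to the class. -/
  IsOp : ∀ S : Finset A, (S → A) → Prop
  incl : ∀ S : Finset A, IsOp S (fun a => a.1)
  restrict : ∀ (R S : Finset A) (h : R ⊆ S) (p : S → A), IsOp S p →
    IsOp R (fun a => p ⟨a.1, h a.2⟩)
  comp : ∀ (S : Finset A) (p : S → A) (r : imageOf p → A), IsOp S p → IsOp (imageOf p) r →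
    IsOp S (fun a => r ⟨p a, mem_imageOf p a⟩)

/-- The supported set of pairs `(p, x)` with `x` in `X` and `p` a map `supp x → A` of the given
class; the support of `(p, x)` is the image of `p`. -/
noncomputable def OpClass.obj {A : Type v} (C : OpClass A) (X : SuppSet.{v, max u v} A) :
    SuppSet.{v, max u v} A where
  carrier := Σ x : X.carrier, {p : X.supp x → A // C.IsOp (X.supp x) p}
  supp t := imageOf t.2.1

/-- The monad `X ↦ {(p, x)}`: maps act by restriction of `p`, the unit sends `x` to the
inclusion of `supp x`, and the multiplication sends `(r, (p, x))` to `(r ∘ p, x)`. -/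
noncomputable def OpClass.monad {A : Type v} (C : OpClass A) :
    CategoryTheory.Monad (SuppSet.{v, max u v} A) where
  obj X := OpClass.obj.{u, v} C X
  map f :=
    { toFun := fun t => ⟨f.toFun t.1, ⟨fun a => t.2.1 ⟨a.1, f.supp_subset t.1 a.2⟩,
        C.restrict _ _ (f.supp_subset t.1) t.2.1 t.2.2⟩⟩
      supp_subset := fun t => imageOf_subset fun _ => mem_imageOf t.2.1 _ }
  map_id _ := rfl
  map_comp _ _ := rfl
  η :=
    { app := fun _ =>
        { toFun := fun x => ⟨x, ⟨fun a => a.1, C.incl _⟩⟩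
          supp_subset := fun _ => imageOf_subset fun a => a.2 }
      naturality := fun _ _ _ => rfl }
  μ :=
    { app := fun _ =>
        { toFun := fun t => ⟨t.1.1, ⟨fun a => t.2.1 ⟨t.1.2.1 a, mem_imageOf t.1.2.1 a⟩,
            C.comp _ t.1.2.1 t.2.1 t.1.2.2 t.2.2⟩⟩
          supp_subset := fun t => imageOf_subset fun _ => mem_imageOf t.2.1 _ }
      naturality := fun _ _ _ => rfl }
  assoc _ := rfl
  left_unit _ := rfl
  right_unit _ := rfl

/-- All injective maps. -/
def injectiveOps (A : Type v) : OpClass A where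
  IsOp _ p := Function.Injective p
  incl _ := Subtype.val_injective
  restrict _ _ _ _ hp _ _ hab := Subtype.ext (Subtype.mk.inj (hp hab))
  comp _ _ _ hp hr _ _ hab := hp (Subtype.mk.inj (hr hab))

/-- All maps. -/
def allOps (A : Type v) : OpClass A where
  IsOp _ _ := True
  incl _ := trivial
  restrict _ _ _ _ _ := trivial
  comp _ _ _ _ _ := trivial

/-- All maps that preserve the strict order. -/
def strictMonoOps (A : Type v) [LinearOrder A] : OpClass A where
  IsOp _ p := ∀ a b, a < b → p a < p b
  incl _ _ _ hab := hab
  restrict _ _ h _ hp a b hab := hp ⟨a.1, h a.2⟩ ⟨b.1, h b.2⟩ hab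
  comp _ _ _ hp hr a b hab := hr _ _ (hp a b hab)

/-! ### The three monoids -/

/-- The finite permutations: bijections fixing all but finitely many atoms. -/
def finPerm (A : Type v) : Submonoid (Function.End A) where
  carrier := {f | Function.Bijective f ∧ {a | f a ≠ a}.Finite}
  one_mem' := ⟨Function.bijective_id,
    Set.finite_empty.subset fun a ha => ha (show (1 : Function.End A) a = a from rfl)⟩
  mul_mem' {f g} hf hg := ⟨hf.1.comp hg.1, (hf.2.union hg.2).subset fun a ha => by
    by_contra h
    simp only [Set.mem_union, Set.mem_ofPred_eq, not_or, not_not] at h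
    exact ha (show f (g a) = a by rw [h.2, h.1])⟩

/-- The finite renamings: maps fixing all but finitely many atoms. -/
def finRename (A : Type v) : Submonoid (Function.End A) where
  carrier := {f | {a | f a ≠ a}.Finite}
  one_mem' := Set.finite_empty.subset fun a ha => ha (show (1 : Function.End A) a = a from rfl)
  mul_mem' {f g} hf hg := (hf.union hg).subset fun a ha => by
    by_contra h
    simp only [Set.mem_union, Set.mem_ofPred_eq, not_or, not_not] at h
    exact ha (show f (g a) = a by rw [h.2, h.1])

/-- The monotone bijections of a linear order. -/
def ordAut (A : Type v) [LinearOrder A] : Submonoid (Function.End A) where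
  carrier := {f | Function.Bijective f ∧ Monotone (f : A → A)}
  one_mem' := ⟨Function.bijective_id, monotone_id⟩
  mul_mem' hf hg := ⟨hf.1.comp hg.1, hf.2.comp hg.2⟩

/-! ### Monadicity -/

/-- `U : D ⥤ C` exhibits `D` as the Eilenberg-Moore category of `T`: there is an isomorphism of
categories (an equivalence that is bijective on objects) `D ≅ EM(T)` that carries `U` to the
forgetful functor of `EM(T)`. -/
def IsMonadicVia {C : Type*} [Category C] {D : Type*} [Category D] (U : D ⥤ C)
    (T : CategoryTheory.Monad C) : Prop :=
  ∃ K : D ⥤ T.Algebra, K.IsEquivalence ∧ Function.Bijective K.obj ∧ K ⋙ T.forget = U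

/-- Nominal `M`-sets are the algebras of the explicit monad of the class `C`, which is the monad
of the adjunction between the free and the forgetful functor: the unit of the adjunction is
`x ↦ ([1], x)`, and the isomorphism of monads sends `([m], x)` to `(m restricted to supp x, x)`. -/
def IsMonadicInstance {A : Type v} (M : Submonoid (Function.End A)) (C : OpClass A) : Prop :=
  IsMonadicVia (forgetToSupp.{v, max u v} M) (OpClass.monad.{u, v} C) ∧
  ∃ adj : free.{u, v} M ⊣ forgetToSupp.{v, max u v} M,
    (∀ (X : SuppSet.{v, max u v} A) (x : X.carrier),
      (adj.unit.app X).toFun x =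
        (⟨x, RestMon.mk (X.supp x) 1⟩ : (freeObj.{u, v} M X).carrier)) ∧
    ∃ φ : adj.toMonad ≅ OpClass.monad.{u, v} C,
      ∀ (X : SuppSet.{v, max u v} A) (x : X.carrier) (m : M),
        ∃ h : C.IsOp (X.supp x) (fun a => m.1 a.1),
          (φ.hom.app X).toFun
              (⟨x, RestMon.mk (X.supp x) m⟩ : (freeObj.{u, v} M X).carrier) =
            (⟨x, ⟨fun a => m.1 a.1, h⟩⟩ : (OpClass.obj.{u, v} C X).carrier)

end Nominal

/-! All three cases are instances of one argument with three inputs: least supports, lock-freeness,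
and `Presents`, which says that the class of maps in the explicit monad consists exactly of the
restrictions of elements of `M` to finite sets.

With least supports, `m • y` depends only on `m` restricted to `supp y`, so a nominal set carries an
action of restrictions. This gives the counit of the adjunction and the structure map of an algebra.
Lock-freeness pins supports down. In a free nominal set the support of `([m], x)` is all of `m[supp
x]` (`supp_free`), which yields the unit and the monad isomorphism. In an algebra the prescribed
support is already the least support of the induced action (`supp_ofAlgebra`), so it is not extra
data and the comparison functor is bijective on objects.

The inputs reduce to extending finite partial maps: by swaps for permutations, by overriding the
identity for renamings, by back-and-forth for monotone bijections. Least supports come from an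
exchange criterion: if supports `S` and `R` are given, `a ∈ S \ R`, and `m`, `m'` agree on `S \
{a}`, one looks for `l = m` on `S` and `l' = m'` on `S` with `l = l'` on `R`. Then `m • x = l • x =
l' • x = m' • x`, so `a` can be dropped from `S`.

For relabelling, the order of `ℚ` is transported along `e` and nominal sets are carried over by
conjugation. -/

namespace Nominal

/-! ### Least supports -/

section LeastSupports

variable {A : Type v} {M : Submonoid (Function.End A)}

theorem Supports.mono {X : Type w} [MulAction M X] {S R : Set A} {x : X} (h : Supports M S x)
    (hSR : S ⊆ R) : Supports M R x :=
  fun m m' hm => h m m' fun a ha => hm a (hSR ha)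

/-- If `S` supports `x`, then the image of `S` under `m` supports `m • x`. -/
theorem Supports.smul {X : Type w} [MulAction M X] {S R : Set A} {x : X} (h : Supports M S x)
    (m : M) (hR : ∀ a ∈ S, m.1 a ∈ R) : Supports M R (m • x) := by
  intro l l' hl
  rw [smul_smul, smul_smul]
  exact h _ _ fun a ha => hl _ (hR a ha)

/-- If an atom of a finite support that is missing from another one can always be dropped, then
least supports exist. -/
theorem admitsLeastSupports_of_exists_smul_eq
    (h : ∀ (S R : Finset A) (a : A), a ∈ S → a ∉ R → ∀ m m' : M,
      (∀ b ∈ S, b ≠ a → m.1 b = m'.1 b) → ∃ l l' : M,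
        (∀ b ∈ S, l.1 b = m.1 b) ∧ (∀ b ∈ S, l'.1 b = m'.1 b) ∧ ∀ b ∈ R, l.1 b = l'.1 b) :
    AdmitsLeastSupports.{v, w} M := by
  classical
  intro X x
  -- A finite support of minimal cardinality turns out to be least: an atom of it missing from
  -- another support could be erased.
  obtain ⟨S, hS, hmin⟩ := WellFounded.has_min (InvImage.wf Finset.card Nat.lt_wfRel.wf)
    {S : Finset A | Supports M (S : Set A) x} (X.nominal x)
  refine ⟨S, hS, fun R hR a ha => ?_⟩
  by_contra haR
  refine hmin (S.erase a) (fun m m' hm => ?_) (Finset.card_erase_lt_of_mem ha)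
  obtain ⟨l, l', hl, hl', hll'⟩ := h S R a ha haR m m' fun b hb hba =>
    hm b (by simp [hb, hba])
  rw [← hS l m hl, hR l l' hll', hS l' m' hl']

theorem AdmitsLeastSupports.supports_supp (h : AdmitsLeastSupports.{v, w} M)
    (X : NomSet.{v, w} M) (x : X.carrier) : Supports M (X.supp x : Set A) x := by
  obtain ⟨S, hS, hmin⟩ := h X x
  exact hS.mono fun a ha => NomSet.mem_supp.2 fun R hR => hmin hR ha

end LeastSupports

/-- The maps of the class `C` are exactly the restrictions of the elements of `M` to finite
sets of atoms. -/
structure Presents {A : Type v} (M : Submonoid (Function.End A)) (C : OpClass A) : Prop where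
  isOp : ∀ (m : M) (S : Finset A), C.IsOp S (fun a => m.1 a.1)
  extend : ∀ (S : Finset A) (p : S → A), C.IsOp S p → ∃ m : M, ∀ a : S, m.1 a.1 = p a

/-! ### Finite permutations and finite renamings -/

section Equality

variable {A : Type v}

theorem coe_perm_mem_finPerm (σ : Equiv.Perm A) (h : {a | σ a ≠ a}.Finite) :
    (⇑σ : Function.End A) ∈ finPerm A :=
  ⟨σ.bijective, h⟩

theorem swap_mem_finPerm [DecidableEq A] (a b : A) :
    (⇑(Equiv.swap a b) : Function.End A) ∈ finPerm A :=
  coe_perm_mem_finPerm _ <| (Set.toFinite {a, b}).subset fun c hc => by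
    by_contra h
    simp only [Set.mem_insert_iff, Set.mem_singleton_iff, not_or] at h
    exact hc (Equiv.swap_apply_of_ne_of_ne h.1 h.2)

/-- Once `m` matches `f` on `S`, composing with the swap of `m a` and `f a` corrects the value at
`a`. It leaves the values on `S` alone, since these differ from `m a` and from `f a` by injectivity.
-/
theorem exists_finPerm_eqOn (S : Finset A) (f : A → A) (hf : Set.InjOn f S) :
    ∃ m : finPerm A, ∀ a ∈ S, m.1 a = f a := by
  classical
  induction S using Finset.induction_on with
  | empty => exact ⟨1, by simp⟩
  | insert a S ha ih =>
    obtain ⟨m, hm⟩ := ih (hf.mono (by simp))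
    refine ⟨⟨_, swap_mem_finPerm (m.1 a) (f a)⟩ * m, fun b hb => ?_⟩
    change Equiv.swap (m.1 a) (f a) (m.1 b) = f b
    rcases Finset.mem_insert.1 hb with rfl | hbS
    · exact Equiv.swap_apply_left _ _
    · have hba : b ≠ a := fun h => ha (h ▸ hbS)
      rw [Equiv.swap_apply_of_ne_of_ne (m.2.1.1.ne hba), hm b hbS]
      rw [hm b hbS]
      exact fun h => hba (hf (by simp [hbS]) (by simp) h)

theorem exists_finRename_eqOn (S : Finset A) (f : A → A) :
    ∃ m : finRename A, ∀ a ∈ S, m.1 a = f a := by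
  classical
  refine ⟨⟨fun a => if a ∈ S then f a else a, S.finite_toSet.subset fun a ha => ?_⟩,
    fun a ha => if_pos ha⟩
  by_contra h
  exact ha (if_neg h)

/-- A total map with the same values as a map on a finite set. -/
theorem exists_total (S : Finset A) (p : S → A) : ∃ f : A → A, ∀ a : S, f a.1 = p a := by
  classical
  exact ⟨fun a => if h : a ∈ S then p ⟨a, h⟩ else a, fun a => dif_pos a.2⟩

theorem presents_finPerm : Presents (finPerm A) (injectiveOps A) where
  isOp m _ _ _ hab := Subtype.ext (m.2.1.1 hab)
  extend S p hp := by
    obtain ⟨f, hf⟩ := exists_total S p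
    obtain ⟨m, hm⟩ := exists_finPerm_eqOn S f fun a ha b hb hab =>
      Subtype.mk.inj (hp (((hf ⟨a, ha⟩).symm.trans hab).trans (hf ⟨b, hb⟩)))
    exact ⟨m, fun a => (hm a a.2).trans (hf a)⟩

theorem presents_finRename : Presents (finRename A) (allOps A) where
  isOp _ _ := trivial
  extend S p _ := by
    obtain ⟨f, hf⟩ := exists_total S p
    obtain ⟨m, hm⟩ := exists_finRename_eqOn S f
    exact ⟨m, fun a => (hm a a.2).trans (hf a)⟩

theorem lockFree_finPerm [Infinite A] : LockFree (finPerm A) := by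
  classical
  intro R a ha
  obtain ⟨c, hc⟩ := Infinite.exists_notMem_finset (insert a R)
  simp only [Finset.mem_insert, not_or] at hc
  refine ⟨_, swap_mem_finPerm a c, fun b hb => ?_, ?_⟩
  · exact Equiv.swap_apply_of_ne_of_ne (ne_of_mem_of_not_mem hb ha)
      (ne_of_mem_of_not_mem hb hc.2)
  · rw [Equiv.swap_apply_left]
    exact hc.1

theorem lockFree_finRename [Infinite A] : LockFree (finRename A) := fun R a ha =>
  let ⟨l, hl, h⟩ := lockFree_finPerm R a ha
  ⟨l, hl.2, h⟩

/-- A countable set embeds into the complement of any finite subset of an infinite set. -/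
theorem exists_injective_notMem [Countable A] [Infinite A] (R : Finset A) :
    ∃ f : A → A, Function.Injective f ∧ ∀ a, f a ∉ R := by
  have : Infinite ((R : Set A)ᶜ : Set A) := R.finite_toSet.infinite_compl.to_subtype
  obtain ⟨g, hg⟩ := exists_injective_nat A
  let i := Infinite.natEmbedding ((R : Set A)ᶜ : Set A)
  exact ⟨fun a => (i (g a)).1, fun a b h => hg (i.injective (Subtype.ext h)),
    fun a => (i (g a)).2⟩

/-- The elements `l` and `l'` follow `m` and `m'` on `S`, and both send the rest of `R` by one
injection that avoids `m[S] ∪ m'[S]`. On `R ∩ S` they agree because `a ∉ R`. -/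
theorem admitsLeastSupports_finPerm [Countable A] [Infinite A] :
    AdmitsLeastSupports.{v, w} (finPerm A) := by
  classical
  refine admitsLeastSupports_of_exists_smul_eq fun S R a _ haR m m' hm => ?_
  obtain ⟨f, hf, hfR⟩ := exists_injective_notMem (S.image m.1 ∪ S.image m'.1)
  have hfS : ∀ n : finPerm A, S.image n.1 ⊆ S.image m.1 ∪ S.image m'.1 →
      ∀ b, ∀ c ∈ S, n.1 c ≠ f b := fun n hn b c hc h =>
    hfR b (hn (h ▸ Finset.mem_image_of_mem _ hc))
  have key : ∀ n : finPerm A, (∀ b, ∀ c ∈ S, n.1 c ≠ f b) →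
      ∃ l : finPerm A, ∀ b ∈ S ∪ R, l.1 b = if b ∈ S then n.1 b else f b := by
    intro n hn
    refine exists_finPerm_eqOn _ _ (Function.Injective.injOn fun b c hbc => ?_)
    split_ifs at hbc with hb hc hc
    · exact n.2.1.1 hbc
    · exact (hn c b hb hbc).elim
    · exact (hn b c hc hbc.symm).elim
    · exact hf hbc
  obtain ⟨l, hl⟩ := key m (hfS m Finset.subset_union_left)
  obtain ⟨l', hl'⟩ := key m' (hfS m' Finset.subset_union_right)
  refine ⟨l, l', fun b hb => ?_, fun b hb => ?_, fun b hb => ?_⟩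
  · rw [hl b (by simp [hb]), if_pos hb]
  · rw [hl' b (by simp [hb]), if_pos hb]
  · rw [hl b (by simp [hb]), hl' b (by simp [hb])]
    split_ifs with h
    · exact hm b h (ne_of_mem_of_not_mem hb haR)
    · rfl

/-- Without injectivity to preserve, the identity serves outside `S`. -/
theorem admitsLeastSupports_finRename : AdmitsLeastSupports.{v, w} (finRename A) := by
  classical
  refine admitsLeastSupports_of_exists_smul_eq fun S R a _ haR m m' hm => ?_
  have key : ∀ n : finRename A,
      ∃ l : finRename A, ∀ b ∈ S ∪ R, l.1 b = if b ∈ S then n.1 b else b :=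
    fun n => exists_finRename_eqOn _ _
  obtain ⟨l, hl⟩ := key m
  obtain ⟨l', hl'⟩ := key m'
  refine ⟨l, l', fun b hb => ?_, fun b hb => ?_, fun b hb => ?_⟩
  · rw [hl b (by simp [hb]), if_pos hb]
  · rw [hl' b (by simp [hb]), if_pos hb]
  · rw [hl b (by simp [hb]), hl' b (by simp [hb])]
    split_ifs with h
    · exact hm b h (ne_of_mem_of_not_mem hb haR)
    · rfl

end Equality

/-! ### Monotone bijections -/

section Order

variable {A : Type v} [LinearOrder A]

theorem strictMono_of_mem_ordAut (m : ordAut A) : StrictMono (m.1 : A → A) :=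
  m.2.2.strictMono_of_injective m.2.1.1

variable [Countable A] [DenselyOrdered A] [NoMinOrder A] [NoMaxOrder A] [Nonempty A]

open Order PartialIso in
/-- In a countable dense linear order without endpoints, finite partial isomorphisms extend to
automorphisms. -/
theorem exists_orderIso_eqOn (S : Finset A) (f : A → A) (hf : StrictMonoOn f S) :
    ∃ o : A ≃o A, ∀ a ∈ S, o a = f a := by
  classical
  cases nonempty_encodable A
  -- Cantor's back-and-forth, started from the graph of `f` on `S`.
  let p : PartialIso A A := ⟨S.image fun a => (a, f a), by
    intro p hp q hq
    obtain ⟨a, ha, rfl⟩ := Finset.mem_image.1 hp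
    obtain ⟨b, hb, rfl⟩ := Finset.mem_image.1 hq
    exact (hf.cmp_map_eq ha hb).symm⟩
  let D : A ⊕ A → Cofinal (PartialIso A A) := fun s =>
    Sum.recOn s (definedAtLeft A) (definedAtRight A)
  let I : Ideal (PartialIso A A) := idealOfCofinals p D
  let F a := funOfIdeal a I (cofinal_meets_idealOfCofinals _ D (Sum.inl a))
  let G b := invOfIdeal b I (cofinal_meets_idealOfCofinals _ D (Sum.inr b))
  refine ⟨OrderIso.ofCmpEqCmp (fun a => (F a).val) (fun b => (G b).val) fun a b => ?_,
    fun a ha => ?_⟩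
  · obtain ⟨g, hg, ha⟩ := (F a).prop
    obtain ⟨h, hh, hb⟩ := (G b).prop
    obtain ⟨k, _, hgk, hhk⟩ := I.directed _ hg _ hh
    exact k.prop (a, _) (hgk ha) (_, b) (hhk hb)
  · change (F a).val = f a
    obtain ⟨g, hg, ha'⟩ := (F a).prop
    obtain ⟨k, _, hgk, hpk⟩ := I.directed _ hg _ (mem_idealOfCofinals p D)
    -- A single partial isomorphism contains both `(a, F a)` and `(a, f a)`, so the two values
    -- coincide.
    have := k.prop (a, _) (hgk ha') (a, f a) (hpk (Finset.mem_image_of_mem _ ha))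
    rw [cmp_self_eq_eq, eq_comm, cmp_eq_eq_iff] at this
    exact this

theorem exists_ordAut_eqOn (S : Finset A) (f : A → A) (hf : StrictMonoOn f S) :
    ∃ m : ordAut A, ∀ a ∈ S, m.1 a = f a := by
  obtain ⟨o, ho⟩ := exists_orderIso_eqOn S f hf
  exact ⟨⟨⇑o, o.bijective, o.monotone⟩, ho⟩

theorem presents_ordAut : Presents (ordAut A) (strictMonoOps A) where
  isOp m _ _ _ hab := strictMono_of_mem_ordAut m hab
  extend S p hp := by
    obtain ⟨f, hf⟩ := exists_total S p
    obtain ⟨m, hm⟩ := exists_ordAut_eqOn S f fun a ha b hb hab => by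
      rw [hf ⟨a, ha⟩, hf ⟨b, hb⟩]
      exact hp _ _ hab
    exact ⟨m, fun a => (hm a a.2).trans (hf a)⟩

theorem lockFree_ordAut : LockFree (ordAut A) := by
  classical
  intro R a ha
  -- Pushing `a` up to a point below every element of `R` above it keeps the order on `insert a R`.
  obtain ⟨c, hac, hcR⟩ := Order.exists_between_finsets {a} {b ∈ R | a < b} (by simp)
  simp only [Finset.mem_singleton, forall_eq] at hac
  simp only [Finset.mem_filter, and_imp] at hcR
  obtain ⟨l, hl⟩ := exists_ordAut_eqOn (insert a R) (Function.update id a c) (by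
    intro b hb d hd hbd
    simp only [Finset.coe_insert, Set.mem_insert_iff, Finset.mem_coe] at hb hd
    by_cases hba : b = a
    · subst hba
      rw [Function.update_self, Function.update_of_ne hbd.ne']
      exact hcR d (hd.resolve_left hbd.ne') hbd
    · rw [Function.update_of_ne hba]
      by_cases hda : d = a
      · subst hda
        rw [Function.update_self]
        exact hbd.trans hac
      · rwa [Function.update_of_ne hda])
  refine ⟨l.1, l.2, fun b hb => ?_, ?_⟩
  · rw [hl b (by simp [hb]), Function.update_of_ne (ne_of_mem_of_not_mem hb ha), id]
  · rw [hl a (by simp), Function.update_self]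
    exact hac.ne'

/-- Both `l` and `l'` are glued from `m` below `a` and `m'` above `a`; they differ only in which of
the two is used at `a`, and `a ∉ R`. The gluing is strictly monotone because `m a ≤ m' a`, which may
be assumed by symmetry. -/
theorem admitsLeastSupports_ordAut : AdmitsLeastSupports.{v, w} (ordAut A) := by
  classical
  refine admitsLeastSupports_of_exists_smul_eq fun S R a _ haR m m' hm => ?_
  wlog hle : m.1 a ≤ m'.1 a generalizing m m'
  · obtain ⟨l, l', hl, hl', hll'⟩ := this m' m (fun b hb hba => (hm b hb hba).symm)
      (le_of_not_ge hle)
    exact ⟨l', l, hl', hl, fun b hb => (hll' b hb).symm⟩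
  have hmono := strictMono_of_mem_ordAut m
  have hmono' := strictMono_of_mem_ordAut m'
  obtain ⟨l, hl⟩ := exists_ordAut_eqOn (S ∪ R) (fun b => if b ≤ a then m.1 b else m'.1 b) (by
    refine StrictMono.strictMonoOn (fun b c hbc => ?_) _
    split_ifs with hb hc hc
    · exact hmono hbc
    · exact (hmono.monotone hb).trans_lt (hle.trans_lt (hmono' (not_le.1 hc)))
    · exact (hb (hbc.le.trans hc)).elim
    · exact hmono' hbc)
  obtain ⟨l', hl'⟩ := exists_ordAut_eqOn (S ∪ R) (fun b => if b < a then m.1 b else m'.1 b) (by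
    refine StrictMono.strictMonoOn (fun b c hbc => ?_) _
    split_ifs with hb hc hc
    · exact hmono hbc
    · exact (hmono hb).trans_le (hle.trans (hmono'.monotone (not_lt.1 hc)))
    · exact (hb (hbc.trans hc)).elim
    · exact hmono' hbc)
  refine ⟨l, l', fun b hb => ?_, fun b hb => ?_, fun b hb => ?_⟩
  · rw [hl b (by simp [hb])]
    split_ifs with h
    · rfl
    · exact (hm b hb (not_le.1 h).ne').symm
  · rw [hl' b (by simp [hb])]
    split_ifs with h
    · exact hm b hb h.ne
    · rfl
  · have hba : b ≠ a := ne_of_mem_of_not_mem hb haR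
    rw [hl b (by simp [hb]), hl' b (by simp [hb])]
    simp only [hba.le_iff_lt]

end Order

/-! ### The free-forgetful adjunction -/

section Adjunction

variable {A : Type v} {M : Submonoid (Function.End A)}

/-- In a free nominal set, the support of `([m], x)` is the image of `supp x` under `m`. -/
theorem supp_free (hl : LockFree M) (X : SuppSet.{v, max u v} A) (x : X.carrier) (m : M) :
    (freeObj.{u, v} M X).supp ⟨x, RestMon.mk (X.supp x) m⟩ =
      imageOf (fun a : X.supp x => m.1 a.1) := by
  apply subset_antisymm
  · intro b hb
    refine NomSet.mem_supp.1 hb _ fun l l' h => Sigma.ext rfl (heq_of_eq ?_)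
    exact Quotient.sound (s := restSetoid M (X.supp x)) fun a ha =>
      h (m.1 a) (mem_imageOf (fun a : X.supp x => m.1 a.1) ⟨a, ha⟩)
  · refine imageOf_subset fun a => NomSet.mem_supp.2 fun R hR => ?_
    by_contra hmR
    -- If `R` missed `m a`, some `l` fixing `R` would move `m a`, yet `l` has to fix `([m], x)`,
    -- that is, to fix `m[supp x]` pointwise.
    obtain ⟨l, hlM, hlR, hne⟩ := hl R _ hmR
    have h := hR ⟨l, hlM⟩ 1 hlR
    have h' := eq_of_heq (Sigma.mk.inj h).2
    exact hne (Quotient.exact (s := restSetoid M (X.supp x)) h' a.1 a.2)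

/-- The unit `x ↦ ([1], x)`. -/
noncomputable def freeUnit (hl : LockFree M) :
    𝟭 (SuppSet.{v, max u v} A) ⟶ free.{u, v} M ⋙ forgetToSupp.{v, max u v} M where
  app X :=
    { toFun := fun x => (⟨x, RestMon.mk (X.supp x) 1⟩ : (freeObj.{u, v} M X).carrier)
      supp_subset := fun x =>
        (supp_free hl X x 1).subset.trans (imageOf_subset fun a => a.2) }
  naturality _ _ _ := rfl

/-- The map `([m], y) ↦ m • y` from the free nominal set on the supported set of a nominal
set. -/
noncomputable def evalFun (hs : AdmitsLeastSupports.{v, max u v} M) (Y : NomSet.{v, max u v} M)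
    (t : (freeObj.{u, v} M ((forgetToSupp M).obj Y)).carrier) : Y.carrier :=
  Quotient.lift (s := restSetoid M (Y.supp t.1)) (fun m : M => m • (show Y.carrier from t.1))
    (fun m m' h => hs.supports_supp Y t.1 m m' h) t.2

/-- The counit `([m], y) ↦ m • y`. -/
noncomputable def freeCounit (hs : AdmitsLeastSupports.{v, max u v} M) :
    forgetToSupp.{v, max u v} M ⋙ free.{u, v} M ⟶ 𝟭 (NomSet.{v, max u v} M) where
  app Y := ⟨{
    toFun := evalFun hs Y
    map_smul' := by
      rintro l ⟨(y : Y.carrier), q⟩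
      induction q using Quotient.inductionOn' with
      | h m => exact mul_smul l m y }⟩
  naturality X Y f := by
    refine NomSet.Hom.ext (MulActionHom.ext ?_)
    rintro ⟨(y : X.carrier), q⟩
    induction q using Quotient.inductionOn' with
    | h m => exact (map_smul f.hom m y).symm

/-- The free functor is left adjoint to the forgetful functor. -/
noncomputable def freeAdj (hs : AdmitsLeastSupports.{v, max u v} M) (hl : LockFree M) :
    free.{u, v} M ⊣ forgetToSupp.{v, max u v} M where
  unit := freeUnit hl
  counit := freeCounit hs
  left_triangle_components X := by
    refine NomSet.Hom.ext (MulActionHom.ext ?_)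
    rintro ⟨x, q⟩
    induction q using Quotient.inductionOn' with
    | h m => exact Sigma.ext rfl (heq_of_eq (congrArg (RestMon.mk (X.supp x)) (mul_one m)))
  right_triangle_components Y := SuppSet.Hom.ext (funext fun y : Y.carrier => one_smul M y)

end Adjunction

/-! ### The explicit description of the monad -/

section MonadIso

variable {A : Type v} {M : Submonoid (Function.End A)} {C : OpClass A}

/-- The class `[m]_S` as the restriction of `m` to `S`. -/
noncomputable def RestMon.equivOps (hp : Presents M C) (S : Finset A) :
    RestMon M S ≃ {p : S → A // C.IsOp S p} :=
  Equiv.ofBijective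
    (Quotient.lift (s := restSetoid M S)
      (fun m : M => (⟨fun a => m.1 a.1, hp.isOp m S⟩ : {p : S → A // C.IsOp S p}))
      fun _ _ h => Subtype.ext (funext fun a => h a.1 a.2))
    ⟨by
      intro q q' h
      induction q using Quotient.inductionOn'
      induction q' using Quotient.inductionOn'
      exact Quotient.sound (s := restSetoid M S) fun a ha =>
        congrFun (Subtype.mk.inj h) ⟨a, ha⟩, by
      rintro ⟨p, h⟩
      obtain ⟨m, hm⟩ := hp.extend S p h
      exact ⟨RestMon.mk S m, Subtype.ext (funext hm)⟩⟩

theorem supp_free_eq (hp : Presents M C) (hl : LockFree M) (X : SuppSet.{v, max u v} A)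
    (t : (freeObj.{u, v} M X).carrier) :
    (freeObj.{u, v} M X).supp t = imageOf (RestMon.equivOps hp (X.supp t.1) t.2).1 := by
  obtain ⟨x, q⟩ := t
  induction q using Quotient.inductionOn' with
  | h m => exact supp_free hl X x m

/-- An isomorphism of supported sets from a bijection that preserves supports. -/
def SuppSet.isoOfEquiv {X Y : SuppSet.{v, w} A} (e : X.carrier ≃ Y.carrier)
    (h : ∀ x, Y.supp (e x) = X.supp x) : X ≅ Y where
  hom := ⟨e, fun x => (h x).subset⟩
  inv := ⟨e.symm, fun y => by rw [← h, e.apply_symm_apply]⟩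
  hom_inv_id := SuppSet.Hom.ext (funext e.symm_apply_apply)
  inv_hom_id := SuppSet.Hom.ext (funext e.apply_symm_apply)

/-- The supported set of a free nominal set consists of the pairs `(m|_{supp x}, x)`. -/
noncomputable def freeIso (hp : Presents M C) (hl : LockFree M) (X : SuppSet.{v, max u v} A) :
    (forgetToSupp.{v, max u v} M).obj ((free.{u, v} M).obj X) ≅ OpClass.obj.{u, v} C X :=
  SuppSet.isoOfEquiv (Equiv.sigmaCongrRight fun x => RestMon.equivOps hp (X.supp x))
    fun t => (supp_free_eq hp hl X t).symm

/-- The monad of the free-forgetful adjunction is the explicit monad. -/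
noncomputable def freeMonadIso (hp : Presents M C) (hs : AdmitsLeastSupports.{v, max u v} M)
    (hl : LockFree M) : (freeAdj.{u, v} hs hl).toMonad ≅ OpClass.monad.{u, v} C :=
  MonadIso.mk
    (NatIso.ofComponents (freeIso hp hl) (by
      intro X Y f
      refine SuppSet.Hom.ext (funext ?_)
      rintro ⟨x, q⟩
      induction q using Quotient.inductionOn'
      rfl))
    (fun X => rfl)
    (by
      intro X
      refine SuppSet.Hom.ext (funext ?_)
      rintro ⟨⟨x, q⟩, r⟩
      induction q using Quotient.inductionOn'
      induction r using Quotient.inductionOn'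
      rfl)

end MonadIso

/-! ### Nominal sets as algebras -/

section Algebras

variable {A : Type v} {M : Submonoid (Function.End A)} {C : OpClass A}

/-- The pair `(m|_{supp x}, x)`. -/
def opPair (hp : Presents M C) (X : SuppSet.{v, max u v} A) (m : M) (x : X.carrier) :
    (OpClass.obj.{u, v} C X).carrier :=
  ⟨x, ⟨fun a => m.1 a.1, hp.isOp m _⟩⟩

/-- This lets every identity about algebras be checked on pairs coming from elements of `M`. -/
theorem exists_opPair_eq (hp : Presents M C) (X : SuppSet.{v, max u v} A)
    (t : (OpClass.obj.{u, v} C X).carrier) : ∃ m x, opPair hp X m x = t := by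
  obtain ⟨x, p, h⟩ := t
  obtain ⟨m, hm⟩ := hp.extend _ p h
  exact ⟨m, x, Sigma.ext rfl (heq_of_eq (Subtype.ext (funext hm)))⟩

/-- The action of restrictions of elements of `M` on a nominal set. -/
noncomputable def opAct (hp : Presents M C) (Y : NomSet.{v, max u v} M)
    (t : (OpClass.obj.{u, v} C ((forgetToSupp M).obj Y)).carrier) : Y.carrier :=
  (hp.extend _ t.2.1 t.2.2).choose • (show Y.carrier from t.1)

/-- The extension chosen in `opAct` agrees with `m` on `supp y`, which supports `y`; the choice is
therefore immaterial. -/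
theorem opAct_opPair (hp : Presents M C) (hs : AdmitsLeastSupports.{v, max u v} M)
    (Y : NomSet.{v, max u v} M) (m : M) (y : Y.carrier) :
    opAct hp Y (opPair hp ((forgetToSupp M).obj Y) m y) = m • y :=
  hs.supports_supp Y y _ _ fun a ha =>
    (hp.extend _ _ (hp.isOp m (Y.supp y))).choose_spec ⟨a, ha⟩

/-- The algebra of a nominal set. -/
noncomputable def algebraOf (hp : Presents M C) (hs : AdmitsLeastSupports.{v, max u v} M)
    (Y : NomSet.{v, max u v} M) : (OpClass.monad.{u, v} C).Algebra where
  A := (forgetToSupp M).obj Y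
  a :=
    { toFun := opAct hp Y
      supp_subset := by
        intro t
        obtain ⟨m, (y : Y.carrier), rfl⟩ := exists_opPair_eq hp _ t
        intro a ha
        replace ha : a ∈ Y.supp (m • y) := opAct_opPair hp hs Y m y ▸ ha
        exact NomSet.mem_supp.1 ha _ ((hs.supports_supp Y y).smul m fun b hb =>
          mem_imageOf (fun a : Y.supp y => m.1 a.1) ⟨b, hb⟩) }
  unit := SuppSet.Hom.ext (funext fun y : Y.carrier =>
    (opAct_opPair hp hs Y 1 y).trans (one_smul M y))
  assoc := by
    refine SuppSet.Hom.ext (funext fun t => ?_)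
    obtain ⟨l, t, rfl⟩ := exists_opPair_eq hp _ t
    obtain ⟨m, (y : Y.carrier), rfl⟩ := exists_opPair_eq hp _ t
    -- The multiplication composes restrictions, so the associativity law becomes `(l * m) • y = l •
    -- (m • y)`.
    refine (opAct_opPair hp hs Y (l * m) y).trans ((mul_smul l m y).trans ?_)
    exact (congrArg (l • ·) (opAct_opPair hp hs Y m y)).symm.trans
      (opAct_opPair hp hs Y l _).symm

/-- The functor from nominal sets to algebras. -/
noncomputable def toAlgebra (hp : Presents M C) (hs : AdmitsLeastSupports.{v, max u v} M) :
    NomSet.{v, max u v} M ⥤ (OpClass.monad.{u, v} C).Algebra where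
  obj := algebraOf hp hs
  map {X Y} f :=
    { f := (forgetToSupp M).map f
      h := by
        refine SuppSet.Hom.ext (funext fun t => ?_)
        obtain ⟨m, (x : X.carrier), rfl⟩ := exists_opPair_eq hp _ t
        refine (opAct_opPair hp hs Y m _).trans ((map_smul f.hom m x).symm.trans ?_)
        exact congrArg f.hom (opAct_opPair hp hs X m x).symm }
  map_id _ := rfl
  map_comp _ _ := rfl

/-- The structure map of an algebra on restrictions of elements of `M`. -/
def algSmul (hp : Presents M C) (B : (OpClass.monad.{u, v} C).Algebra) (m : M)
    (x : B.A.carrier) : B.A.carrier :=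
  B.a.toFun (opPair hp B.A m x)

theorem algSmul_congr (hp : Presents M C) (B : (OpClass.monad.{u, v} C).Algebra) {m m' : M}
    {x : B.A.carrier} (h : ∀ a ∈ B.A.supp x, m.1 a = m'.1 a) :
    algSmul hp B m x = algSmul hp B m' x :=
  congrArg B.a.toFun
    (Sigma.ext rfl (heq_of_eq (Subtype.ext (funext fun a => h a.1 a.2))))

theorem supp_algSmul (hp : Presents M C) (B : (OpClass.monad.{u, v} C).Algebra) (m : M)
    (x : B.A.carrier) : B.A.supp (algSmul hp B m x) ⊆ imageOf fun a : B.A.supp x => m.1 a.1 :=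
  B.a.supp_subset (opPair hp B.A m x)

/-- The nominal set of an algebra. -/
def ofAlgebra (hp : Presents M C) (B : (OpClass.monad.{u, v} C).Algebra) :
    NomSet.{v, max u v} M where
  carrier := B.A.carrier
  action :=
    { smul := algSmul hp B
      one_smul := fun x => congrFun (congrArg SuppSet.Hom.toFun B.unit) x
      mul_smul := fun l m x => congrFun (congrArg SuppSet.Hom.toFun B.assoc)
        (opPair hp (OpClass.obj.{u, v} C B.A) l (opPair hp B.A m x)) }
  nominal x := ⟨B.A.supp x, fun _ _ h => algSmul_congr hp B h⟩

/-- Suppose `a` lies in the prescribed support but not in a support `R`. Take `l` moving `a` and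
fixing `R` and the other atoms of `supp x`. Then `l • x = x`, so `a ∈ supp x ⊆ l[supp x]`; but `l`
sends `a` elsewhere and fixes the remaining atoms, so `a` is not in that image. -/
theorem supp_ofAlgebra (hp : Presents M C) (hl : LockFree M)
    (B : (OpClass.monad.{u, v} C).Algebra) (x : B.A.carrier) :
    (ofAlgebra hp B).supp x = B.A.supp x := by
  classical
  apply subset_antisymm
  · exact fun a ha => NomSet.mem_supp.1 ha _ fun _ _ h => algSmul_congr hp B h
  · refine fun a ha => NomSet.mem_supp.2 fun R hR => ?_
    by_contra haR
    obtain ⟨l, hlM, hlR, hne⟩ := hl (R ∪ (B.A.supp x).erase a) a (by simp [haR])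
    have hlx : algSmul hp B ⟨l, hlM⟩ x = x :=
      (hR ⟨l, hlM⟩ 1 fun b hb => hlR b (Finset.mem_union_left _ hb)).trans
        (one_smul M (show (ofAlgebra hp B).carrier from x))
    have ha' := supp_algSmul hp B ⟨l, hlM⟩ x (by rwa [hlx])
    obtain ⟨⟨b, hb⟩, hba⟩ := (Set.finite_range _).mem_toFinset.1 ha'
    change l b = a at hba
    by_cases h : b = a
    · exact hne (h ▸ hba)
    · exact h ((hlR b (by simp [h, hb])).symm.trans hba)

theorem nomSet_ext {X : Type w} {i j : MulAction M X}
    {hi : ∀ x : X, ∃ S : Finset A, @Supports A M X i (S : Set A) x}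
    {hj : ∀ x : X, ∃ S : Finset A, @Supports A M X j (S : Set A) x}
    (h : ∀ (m : M) (x : X), i.smul m x = j.smul m x) :
    (@NomSet.mk A M X i hi : NomSet.{v, w} M) = @NomSet.mk A M X j hj := by
  obtain rfl : i = j := MulAction.ext (funext fun m => funext fun x => h m x)
  rfl

/-- The support map is a separate variable `s` so that `hB'` holds by `rfl` in the application,
where the supports are equal only by a theorem. -/
theorem algebra_ext (hp : Presents M C) {B : (OpClass.monad.{u, v} C).Algebra}
    {s : B.A.carrier → Finset A} (hs : s = B.A.supp)
    {B' : (OpClass.monad.{u, v} C).Algebra} (hB' : B'.A = ⟨B.A.carrier, s⟩)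
    (h : ∀ (m : M) (x : B.A.carrier), HEq (algSmul hp B m x)
      (algSmul hp B' m (cast (congrArg SuppSet.carrier hB').symm x))) : B' = B := by
  obtain ⟨X, b, _, _⟩ := B
  obtain ⟨X', b', _, _⟩ := B'
  subst hs
  obtain rfl : X' = X := hB'
  obtain rfl : b' = b := SuppSet.Hom.ext (funext fun t => by
    obtain ⟨m, x, rfl⟩ := exists_opPair_eq hp _ t
    exact (eq_of_heq (h m x)).symm)
  rfl

theorem ofAlgebra_algebraOf (hp : Presents M C) (hs : AdmitsLeastSupports.{v, max u v} M)
    (Y : NomSet.{v, max u v} M) : ofAlgebra hp (algebraOf hp hs Y) = Y :=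
  nomSet_ext fun m y => opAct_opPair hp hs Y m y

theorem algebraOf_ofAlgebra (hp : Presents M C) (hs : AdmitsLeastSupports.{v, max u v} M)
    (hl : LockFree M) (B : (OpClass.monad.{u, v} C).Algebra) :
    algebraOf hp hs (ofAlgebra hp B) = B :=
  algebra_ext hp (funext (supp_ofAlgebra hp hl B)) rfl fun m x =>
    heq_of_eq (opAct_opPair hp hs (ofAlgebra hp B) m x).symm

theorem toAlgebra_obj_bijective (hp : Presents M C) (hs : AdmitsLeastSupports.{v, max u v} M)
    (hl : LockFree M) : Function.Bijective (toAlgebra.{u, v} hp hs).obj :=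
  ⟨Function.LeftInverse.injective (ofAlgebra_algebraOf hp hs),
    Function.RightInverse.surjective (algebraOf_ofAlgebra hp hs hl)⟩

theorem essSurj_of_obj_surjective {D : Type*} [Category D] {E : Type*} [Category E] {K : D ⥤ E}
    (h : Function.Surjective K.obj) : K.EssSurj where
  mem_essImage Y := (h Y).elim fun X hX => ⟨X, ⟨eqToIso hX⟩⟩

/-- Morphisms on both sides are functions between the same sets, and the algebra square evaluated at
`(m|_{supp x}, x)` is equivariance. -/
theorem toAlgebra_isEquivalence (hp : Presents M C) (hs : AdmitsLeastSupports.{v, max u v} M)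
    (hl : LockFree M) : (toAlgebra.{u, v} hp hs).IsEquivalence where
  faithful := ⟨fun h => NomSet.Hom.ext <| MulActionHom.ext fun x =>
    congrFun (congrArg (fun k => SuppSet.Hom.toFun (Monad.Algebra.Hom.f k)) h) x⟩
  full := ⟨fun {X Y} k => ⟨⟨{
    toFun := k.f.toFun
    map_smul' := fun m x => by
      have h := congrFun (congrArg SuppSet.Hom.toFun k.h)
        (opPair hp ((forgetToSupp M).obj X) m x)
      exact ((congrArg k.f.toFun (opAct_opPair hp hs X m x)).symm.trans h.symm).trans
        (opAct_opPair hp hs Y m (k.f.toFun x)) }⟩, rfl⟩⟩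
  essSurj := essSurj_of_obj_surjective (toAlgebra_obj_bijective hp hs hl).2

theorem Presents.isMonadicVia (hp : Presents M C) (hs : AdmitsLeastSupports.{v, max u v} M)
    (hl : LockFree M) :
    IsMonadicVia (forgetToSupp.{v, max u v} M) (OpClass.monad.{u, v} C) :=
  ⟨toAlgebra hp hs, toAlgebra_isEquivalence hp hs hl, toAlgebra_obj_bijective hp hs hl, rfl⟩

theorem Presents.isMonadicInstance (hp : Presents M C)
    (hs : AdmitsLeastSupports.{v, max u v} M) (hl : LockFree M) :
    IsMonadicInstance.{u, v} M C :=
  ⟨hp.isMonadicVia hs hl, freeAdj hs hl, fun _ _ => rfl, freeMonadIso hp hs hl,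
    fun _ _ m => ⟨hp.isOp m _, rfl⟩⟩

end Algebras

/-! ### Relabelling atoms -/

section Relabel

variable {A : Type u} {B : Type v} {M : Submonoid (Function.End A)}
  {N : Submonoid (Function.End B)}

theorem supports_compHom {e : A ≃ B} {φ : N ≃* M}
    (hφ : ∀ (n : N) (a : A), e ((φ n).1 a) = n.1 (e a)) {X : Type w} [MulAction M X] {S : Set A}
    {R : Set B} {x : X} (h : Supports M S x) (hR : ∀ a ∈ S, e a ∈ R) :
    @Supports B N X (MulAction.compHom X φ.toMonoidHom) R x :=
  fun n n' hn => h (φ n) (φ n') fun a ha => e.injective <| by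
    rw [hφ, hφ, hn _ (hR a ha)]

/-- Transport of nominal sets along a conjugation of monoids of maps. -/
def conj (e : A ≃ B) (φ : N ≃* M) (hφ : ∀ (n : N) (a : A), e ((φ n).1 a) = n.1 (e a)) :
    NomSet.{u, w} M ⥤ NomSet.{v, w} N where
  obj X :=
    { carrier := X.carrier
      action := MulAction.compHom X.carrier φ.toMonoidHom
      nominal := fun x => (X.nominal x).elim fun S hS =>
        ⟨S.map e.toEmbedding, supports_compHom hφ hS fun _ => Finset.mem_map_of_mem e.toEmbedding⟩ }
  map {X Y} f := ⟨{
    toFun := f.hom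
    map_smul' := fun n x => map_smul f.hom (φ n) (show X.carrier from x) }⟩

theorem conj_symm_apply {e : A ≃ B} {φ : N ≃* M}
    (hφ : ∀ (n : N) (a : A), e ((φ n).1 a) = n.1 (e a)) (m : M) (b : B) :
    e.symm ((φ.symm m).1 b) = m.1 (e.symm b) := by
  rw [Equiv.symm_apply_eq]
  simpa using (hφ (φ.symm m) (e.symm b)).symm

theorem conj_conj_obj {e : A ≃ B} {φ : N ≃* M}
    (hφ : ∀ (n : N) (a : A), e ((φ n).1 a) = n.1 (e a)) (X : NomSet.{u, w} M) :
    (conj e.symm φ.symm (conj_symm_apply hφ)).obj ((conj e φ hφ).obj X) = X :=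
  nomSet_ext fun m x => congrArg (fun l : M => l • (show X.carrier from x))
    (φ.apply_symm_apply m)

theorem conj_obj_bijective {e : A ≃ B} {φ : N ≃* M}
    (hφ : ∀ (n : N) (a : A), e ((φ n).1 a) = n.1 (e a)) :
    Function.Bijective (conj.{u, v, w} e φ hφ).obj :=
  ⟨Function.LeftInverse.injective (conj_conj_obj hφ),
    Function.RightInverse.surjective (conj_conj_obj (conj_symm_apply hφ))⟩

theorem conj_isEquivalence {e : A ≃ B} {φ : N ≃* M}
    (hφ : ∀ (n : N) (a : A), e ((φ n).1 a) = n.1 (e a)) :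
    (conj.{u, v, w} e φ hφ).IsEquivalence where
  faithful := ⟨fun h => NomSet.Hom.ext <| MulActionHom.ext fun x =>
    congrFun (congrArg (fun k => (NomSet.Hom.hom k).toFun) h) x⟩
  full := ⟨fun {_ Y} k => ⟨⟨{
    toFun := k.hom.toFun
    map_smul' := fun m x =>
      (congrArg (fun l : M => k.hom.toFun (l • x)) (φ.apply_symm_apply m)).symm.trans <|
        (k.hom.map_smul' (φ.symm m) x).trans <|
        congrArg (fun l : M => l • (show Y.carrier from k.hom.toFun x))
          (φ.apply_symm_apply m) }⟩, rfl⟩⟩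
  essSurj := essSurj_of_obj_surjective (conj_obj_bijective hφ).2

theorem map_supp_subset_supp_conj {e : A ≃ B} {φ : N ≃* M}
    (hφ : ∀ (n : N) (a : A), e ((φ n).1 a) = n.1 (e a)) (X : NomSet.{u, w} M)
    (x : X.carrier) : (X.supp x).map e.toEmbedding ⊆ ((conj e φ hφ).obj X).supp x := by
  intro b hb
  obtain ⟨a, ha, rfl⟩ := Finset.mem_map.1 hb
  refine NomSet.mem_supp.2 fun S hS => ?_
  have hS' : Supports M ((S.map e.symm.toEmbedding : Finset A) : Set A) x := fun m m' hm => by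
    have := hS (φ.symm m) (φ.symm m') fun b hb => e.symm.injective <| by
      rw [conj_symm_apply hφ, conj_symm_apply hφ]
      exact hm _ (by simpa using hb)
    change φ (φ.symm m) • x = φ (φ.symm m') • x at this
    rwa [φ.apply_symm_apply, φ.apply_symm_apply] at this
  simpa using NomSet.mem_supp.1 ha _ hS'

theorem supp_conj {e : A ≃ B} {φ : N ≃* M}
    (hφ : ∀ (n : N) (a : A), e ((φ n).1 a) = n.1 (e a)) (X : NomSet.{u, w} M)
    (x : X.carrier) : ((conj e φ hφ).obj X).supp x = (X.supp x).map e.toEmbedding := by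
  refine subset_antisymm (fun b hb => ?_) (map_supp_subset_supp_conj hφ X x)
  refine Finset.mem_map_equiv.2 (NomSet.mem_supp.2 fun S hS => Finset.mem_map_equiv.1 ?_)
  exact NomSet.mem_supp.1 hb (S.map e.toEmbedding)
    (supports_compHom (X := X.carrier) hφ hS fun _ => Finset.mem_map_of_mem e.toEmbedding)

/-- Needed for equality of functors whose values on objects have supports that agree only
propositionally. -/
theorem hom_heq {X Y : Type w} {s s' : X → Finset A} {t t' : Y → Finset A} (hs : s = s')
    (ht : t = t') {f : SuppSet.Hom ⟨X, s⟩ ⟨Y, t⟩} {f' : SuppSet.Hom ⟨X, s'⟩ ⟨Y, t'⟩}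
    (h : f.toFun = f'.toFun) : HEq f f' := by
  subst hs ht
  exact heq_of_eq (SuppSet.Hom.ext h)

theorem conj_comp_forgetToSupp {e : A ≃ B} {φ : N ≃* M}
    (hφ : ∀ (n : N) (a : A), e ((φ n).1 a) = n.1 (e a)) :
    conj.{u, v, w} e φ hφ ⋙ forgetToSupp N = forgetToSupp M ⋙ SuppSet.relabel e := by
  have h : ∀ X : NomSet.{u, w} M, ((conj e φ hφ).obj X).supp =
      fun x : X.carrier => (X.supp x).map e.toEmbedding := fun X => funext (supp_conj hφ X)
  exact Functor.hext (fun X => congrArg (SuppSet.mk X.carrier) (h X))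
    fun X Y f => hom_heq (h X) (h Y) rfl

theorem IsMonadicVia.relabel {e : A ≃ B} {φ : N ≃* M}
    (hφ : ∀ (n : N) (a : A), e ((φ n).1 a) = n.1 (e a))
    {T : CategoryTheory.Monad (SuppSet.{v, w} B)}
    (h : IsMonadicVia (forgetToSupp.{v, w} N) T) :
    IsMonadicVia (forgetToSupp.{u, w} M ⋙ SuppSet.relabel e) T := by
  obtain ⟨K, hK, hobj, hU⟩ := h
  have := conj_isEquivalence.{u, v, w} hφ
  refine ⟨conj e φ hφ ⋙ K, inferInstance, hobj.comp (conj_obj_bijective hφ), ?_⟩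
  rw [Functor.assoc, hU, conj_comp_forgetToSupp]

/-- Conjugation of monotone bijections by an order isomorphism. -/
def ordAutCongr [LinearOrder A] [LinearOrder B] (o : A ≃o B) : ordAut B ≃* ordAut A where
  toFun n := ⟨fun a => o.symm (n.1 (o a)),
    o.symm.bijective.comp (n.2.1.comp o.bijective),
    o.symm.monotone.comp (n.2.2.comp o.monotone)⟩
  invFun m := ⟨fun b => o (m.1 (o.symm b)),
    o.bijective.comp (m.2.1.comp o.symm.bijective),
    o.monotone.comp (m.2.2.comp o.symm.monotone)⟩
  left_inv n := Subtype.ext (funext fun b => by simp)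
  right_inv m := Subtype.ext (funext fun a => by simp)
  map_mul' n n' := Subtype.ext (funext fun a => by
    change o.symm (n.1 (n'.1 (o a))) = o.symm (n.1 (o (o.symm (n'.1 (o a)))))
    rw [o.apply_symm_apply])

end Relabel

/-- Relabelling the atoms of nominal sets for the total order symmetry preserves monadicity. -/
theorem exists_isMonadicVia_relabel {A : Type v} (e : ℚ ≃ A) :
    ∃ T : CategoryTheory.Monad (SuppSet.{v, max u v} A),
      IsMonadicVia (forgetToSupp.{0, max u v} (ordAut ℚ) ⋙ SuppSet.relabel e) T := by
  -- With this order `e` is an order isomorphism, so the general theorem for `ordAut A` supplies the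
  -- monad.
  let : LinearOrder A := LinearOrder.lift' e.symm e.symm.injective
  let o : ℚ ≃o A := ⟨e, fun {a b} => by
    change e.symm (e a) ≤ e.symm (e b) ↔ a ≤ b
    simp⟩
  have : Countable A := e.symm.injective.countable
  have : DenselyOrdered A := (denselyOrdered_iff_of_orderIsoClass o).1 inferInstance
  have : NoMinOrder A := ⟨fun a => ⟨o (o.symm a - 1), by
    rw [← o.lt_symm_apply]; linarith⟩⟩
  have : NoMaxOrder A := ⟨fun a => ⟨o (o.symm a + 1), by
    rw [← o.symm_apply_lt]; linarith⟩⟩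
  have : Nonempty A := ⟨e 0⟩
  exact ⟨OpClass.monad.{u, v} (strictMonoOps A),
    IsMonadicVia.relabel (φ := ordAutCongr o) (fun n a => o.apply_symm_apply (n.1 (o a)))
      (presents_ordAut.isMonadicVia admitsLeastSupports_ordAut lockFree_ordAut)⟩

end Nominal

theorem mainTheorem2 (A : Type v) [Countable A] [Infinite A] :
    -- nominal sets for the equality symmetry
    (Nominal.AdmitsLeastSupports.{v, max u v} (Nominal.finPerm A) ∧
      Nominal.LockFree (Nominal.finPerm A) ∧
      Nominal.IsMonadicInstance.{u, v} (Nominal.finPerm A) (Nominal.injectiveOps A)) ∧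
    -- nominal renaming sets
    (Nominal.AdmitsLeastSupports.{v, max u v} (Nominal.finRename A) ∧
      Nominal.LockFree (Nominal.finRename A) ∧
      Nominal.IsMonadicInstance.{u, v} (Nominal.finRename A) (Nominal.allOps A)) ∧
    -- nominal sets for the total order symmetry
    (Nominal.AdmitsLeastSupports.{0, u} (Nominal.ordAut ℚ) ∧
      Nominal.LockFree (Nominal.ordAut ℚ) ∧
      Nominal.IsMonadicInstance.{u, 0} (Nominal.ordAut ℚ) (Nominal.strictMonoOps ℚ)) ∧
    -- hence they are monadic over the supported sets over `A` as well, via `ℚ ≃ A`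
    Nonempty (ℚ ≃ A) ∧
    ∀ e : ℚ ≃ A, ∃ T : CategoryTheory.Monad (Nominal.SuppSet.{v, max u v} A),
      Nominal.IsMonadicVia
        (CategoryTheory.Functor.comp (Nominal.forgetToSupp.{0, max u v} (Nominal.ordAut ℚ))
          (Nominal.SuppSet.relabel.{0, v, max u v} e)) T :=
  ⟨⟨Nominal.admitsLeastSupports_finPerm, Nominal.lockFree_finPerm,
      Nominal.presents_finPerm.isMonadicInstance Nominal.admitsLeastSupports_finPerm
        Nominal.lockFree_finPerm⟩,
    ⟨Nominal.admitsLeastSupports_finRename, Nominal.lockFree_finRename,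
      Nominal.presents_finRename.isMonadicInstance Nominal.admitsLeastSupports_finRename
        Nominal.lockFree_finRename⟩,
    ⟨Nominal.admitsLeastSupports_ordAut, Nominal.lockFree_ordAut,
      Nominal.presents_ordAut.isMonadicInstance Nominal.admitsLeastSupports_ordAut
        Nominal.lockFree_ordAut⟩,
    nonempty_equiv_of_countable, fun e => Nominal.exists_isMonadicVia_relabel e⟩
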